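/- Consider the binary deletion channel with deletion probability $d\in[0,1]$: each bit of an $n$-bit input word $X$ is deleted independently with probability $d$, and the receiver sees only the string $Y$ of surviving bits, in their original order. Its capacity, in bits per channel use, can be expressed in two standard ways (equal by Dobrushin's coding theorem): as the supremum $\mathrm{Cap}(d)$ of the achievable rates $R$, where $R$ is achievable if for every $\varepsilon>0$ and all sufficiently large $n$ there is a code of block length $n$ with at least $2^{nR}$ messages that recovers a uniformly random message with failure probability at most $\varepsilon$; and as the limit $\mathrm{Cap}(d)=\lim_{n\to\infty}\frac1n\sup I(X;Y)$, the supremum being over all distributions of the $n$-bit word $X$ and $I$ being mutual information in bits. For each $d \in [0,1]$ this supremum is a finite real number and this limit exists. Let $\varphi=(1+\sqrt5)/2$ be the golden ratio. Then, with $\mathrm{Cap}$ taken in either sense: 1. for every $d\in[1/2,1]$, unconditionally, $\mathrm{Cap}(d)\le(1-d)\log_2\varphi$; 2. if the function $\mathrm{Cap}$ is convex on $[0,1/2]$, then for every $d\in[0,1/2)$, $\mathrm{Cap}(d)\le 1-d\log_2(4/\varphi)$. -/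

import Mathlib

open Filter Topology

noncomputable section

namespace DeletionChannel

/-- The string received when the `n`-bit word `x` is sent and exactly the bits at the positions
in `S` survive: the surviving bits, in their original order. -/
def received {n : ℕ} (x : Fin n → Bool) (S : Finset (Fin n)) : List Bool :=
  ((List.finRange n).filter (fun i => i ∈ S)).map x

/-- The probability that exactly the positions in `S` survive, when each of the `n` bits is
deleted independently with probability `d`. -/
def survivalProb (d : ℝ) {n : ℕ} (S : Finset (Fin n)) : ℝ :=
  (1 - d) ^ S.card * d ^ (n - S.card)

/-- The transition law of `n` uses of the deletion channel: the probability that the string `y` is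
received when the word `x` is sent. -/
def transition (d : ℝ) {n : ℕ} (x : Fin n → Bool) (y : List Bool) : ℝ :=
  ∑ S : Finset (Fin n), if received x S = y then survivalProb d S else 0

/-! ### Capacity as the largest achievable rate -/

/-- The failure probability of a block code with `M` messages, block length `n`, encoder `enc` and
decoder `dec`, for a message that is uniformly distributed. -/
def failureProb (d : ℝ) {n M : ℕ} (enc : Fin M → Fin n → Bool) (dec : List Bool → Fin M) : ℝ :=
  (∑ m : Fin M, ∑ S : Finset (Fin n),
    if dec (received (enc m) S) = m then 0 else survivalProb d S) / M

/-- The rate `R` (in bits per channel use) is achievable: for each `ε > 0` there are, for all large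
block lengths `n`, codes with at least `2 ^ (n R)` messages and failure probability at
most `ε`. -/
def IsAchievableRate (d R : ℝ) : Prop :=
  ∀ ε : ℝ, 0 < ε → ∀ᶠ n : ℕ in atTop,
    ∃ (M : ℕ) (enc : Fin M → Fin n → Bool) (dec : List Bool → Fin M),
      (2 : ℝ) ^ ((n : ℝ) * R) ≤ (M : ℝ) ∧ failureProb d enc dec ≤ ε

/-- The (operational) capacity: the supremum of the achievable rates. -/
def capacity (d : ℝ) : ℝ := sSup {R : ℝ | IsAchievableRate d R}

/-! ### Capacity as the limit of the normalized maximal mutual information -/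

/-- All strings that can be received over `n` uses of the channel. -/
def outputs (n : ℕ) : Finset (List Bool) :=
  Finset.univ.image fun p : (Fin n → Bool) × Finset (Fin n) => received p.1 p.2

/-- The distribution of the received string `Y` when the input word has distribution `P`. -/
def outputProb (d : ℝ) {n : ℕ} (P : (Fin n → Bool) → ℝ) (y : List Bool) : ℝ :=
  ∑ x : Fin n → Bool, P x * transition d x y

/-- The mutual information `I(X; Y)`, in bits, between the input word `X` with distribution `P` and
the received string `Y`. -/
def mutualInfo (d : ℝ) {n : ℕ} (P : (Fin n → Bool) → ℝ) : ℝ :=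
  ∑ x : Fin n → Bool, ∑ y ∈ outputs n,
    P x * transition d x y * Real.logb 2 (transition d x y / outputProb d P y)

/-- The supremum of `I(X; Y)` over all distributions of the `n`-bit input word `X`. -/
def maxMutualInfo (d : ℝ) (n : ℕ) : ℝ :=
  sSup ((fun P => mutualInfo d P) '' stdSimplex ℝ (Fin n → Bool))

/-- The information capacity: the limit of `sup I(X; Y) / n`. -/
def informationCapacity (d : ℝ) : ℝ :=
  limUnder atTop fun n : ℕ => maxMutualInfo d n / n

end DeletionChannel

end

/-!
Both capacities are bounded by the divergence radius of the channel: if every transition law of the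
`n`-use channel is within relative entropy `r` of one reference law, then `r` bounds the mutual
information by the compensation identity and, up to lower order terms, the logarithm of the size of
a good code by Fano's inequality. The limit of the normalized mutual information exists because
concatenation makes its maximum subadditive.

For `d ≥ 1/2` the reference law makes the runs of `y` independent, a run of length `r` having weight
`√(1 - q) C(2r, r) (q / 4) ^ r`. At `d = 1/2` a run of `k` letters is received as a run whose length
is a fair binomial variable. The binomial coefficients cancel in its divergence up to the growth of
factorials, which Jensen's inequality controls, and for `q = 1 / φ` there remains at most
`(k / 2 + 1) log φ`. For larger `d` a deletion step is a convex combination of the identity and the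
step with `d = 1/2`, and a letter which differs from the run in progress either vanishes or closes
that run; in both cases convexity of the divergence yields a cost of `(1 - d) log φ` per letter.

Below `1/2` the second bound is the chord through the trivial bound at `0` and the first at `1/2`.
-/

noncomputable section

namespace DeletionChannel

section RelativeEntropy

variable {ι κ μ : Type*}

/-- The summand `a log (a / b)` of a relative entropy, in nats. By the conventions for `0⁻¹` and
`log 0` it vanishes when `a = 0` or `b = 0`. -/
def klTerm (a b : ℝ) : ℝ := a * Real.log (a / b)

lemma klTerm_zero_left (b : ℝ) : klTerm 0 b = 0 := zero_mul _

lemma klTerm_mul_mul {a b a' b' : ℝ} (h : b = 0 → a = 0) (h' : b' = 0 → a' = 0) :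
    klTerm (a * a') (b * b') = klTerm a b * a' + a * klTerm a' b' := by
  rcases eq_or_ne a 0 with rfl | ha
  · simp only [klTerm, zero_mul, add_zero]
  rcases eq_or_ne a' 0 with rfl | ha'
  · simp only [klTerm, zero_mul, mul_zero, add_zero]
  have hb : b ≠ 0 := mt h ha
  have hb' : b' ≠ 0 := mt h' ha'
  rw [klTerm, klTerm, klTerm, mul_div_mul_comm, Real.log_mul (by positivity) (by positivity)]
  ring

lemma klTerm_eq_mul_log_sub {a b : ℝ} (h : b = 0 → a = 0) :
    klTerm a b = a * Real.log a - a * Real.log b := by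
  rcases eq_or_ne a 0 with rfl | ha
  · simp only [klTerm, zero_mul, sub_self]
  · rw [klTerm, Real.log_div ha (mt h ha), mul_sub]

lemma mul_log_add_sub_mul_le_klTerm {a b t : ℝ} (ha : 0 ≤ a) (hb : 0 ≤ b) (h : b = 0 → a = 0)
    (ht : 0 < t) : a * Real.log t + a - b * t ≤ klTerm a b := by
  rcases ha.eq_or_lt with rfl | ha
  · simpa only [klTerm, zero_mul, zero_add, zero_sub, neg_nonpos] using mul_nonneg hb ht.le
  have hb : 0 < b := hb.lt_of_ne' (mt h ha.ne')
  have log_le : Real.log (t / (a / b)) ≤ t / (a / b) - 1 :=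
    Real.log_le_sub_one_of_pos (by positivity)
  rw [Real.log_div ht.ne' (by positivity)] at log_le
  calc a * Real.log t + a - b * t
      = a * Real.log t - a * (t / (a / b) - 1) := by field_simp; ring
    _ ≤ a * Real.log t - a * (Real.log t - Real.log (a / b)) := by gcongr
    _ = klTerm a b := by rw [klTerm]; ring

lemma klTerm_sum_le_sum_klTerm (s : Finset ι) {a b : ι → ℝ} (ha : ∀ i ∈ s, 0 ≤ a i)
    (hb : ∀ i ∈ s, 0 ≤ b i) (h : ∀ i ∈ s, b i = 0 → a i = 0) :
    klTerm (∑ i ∈ s, a i) (∑ i ∈ s, b i) ≤ ∑ i ∈ s, klTerm (a i) (b i) := by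
  rcases (Finset.sum_nonneg ha).eq_or_lt with hA | hA
  · have a_eq_zero : ∀ i ∈ s, a i = 0 := (Finset.sum_eq_zero_iff_of_nonneg ha).1 hA.symm
    rw [← hA, klTerm_zero_left]
    exact (Finset.sum_eq_zero fun i hi => by rw [a_eq_zero i hi, klTerm_zero_left]).ge
  have hB : 0 < ∑ i ∈ s, b i := (Finset.sum_nonneg hb).lt_of_ne' fun hB => hA.ne' <|
    Finset.sum_eq_zero fun i hi => h i hi ((Finset.sum_eq_zero_iff_of_nonneg hb).1 hB i hi)
  set t := (∑ i ∈ s, a i) / ∑ i ∈ s, b i with ht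
  calc klTerm (∑ i ∈ s, a i) (∑ i ∈ s, b i)
      = ∑ i ∈ s, (a i * Real.log t + a i - b i * t) := by
        rw [Finset.sum_sub_distrib, Finset.sum_add_distrib, ← Finset.sum_mul, ← Finset.sum_mul,
          klTerm, ht, mul_div_cancel₀ _ hB.ne', add_sub_cancel_right]
    _ ≤ ∑ i ∈ s, klTerm (a i) (b i) := Finset.sum_le_sum fun i hi =>
        mul_log_add_sub_mul_le_klTerm (ha i hi) (hb i hi) (h i hi) (div_pos hA hB)

lemma convexOn_klTerm (b : ℝ) : ConvexOn ℝ (Set.Ici 0) fun a => klTerm a b := by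
  rcases eq_or_ne b 0 with rfl | hb
  · simpa only [klTerm, div_zero, Real.log_zero, mul_zero] using convexOn_const 0 (convex_Ici 0)
  · have linear : ConcaveOn ℝ (Set.Ici 0) fun a => a * Real.log b :=
      (LinearMap.mulRight ℝ (Real.log b)).concaveOn (convex_Ici 0)
    refine (Real.convexOn_mul_log.sub linear).congr fun a _ => ?_
    exact (klTerm_eq_mul_log_sub fun h => absurd h hb).symm

/-- A finitely supported probability law, encoded as its mass function. -/
structure IsLaw (p : ι →₀ ℝ) : Prop where
  nonneg : 0 ≤ p
  mass_eq_one : Finsupp.linearCombination ℝ (fun _ => (1 : ℝ)) p = 1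

lemma linearCombination_eq_sum {p : ι →₀ ℝ} {s : Finset ι} (hs : p.support ⊆ s) (f : ι → ℝ) :
    Finsupp.linearCombination ℝ f p = ∑ i ∈ s, p i * f i :=
  Finsupp.sum_of_support_subset _ hs _ fun i _ => zero_smul ℝ (f i)

lemma isLaw_single (i : ι) : IsLaw (Finsupp.single i 1) :=
  ⟨Finsupp.single_nonneg.2 zero_le_one, by simp⟩

lemma isLaw_equivFunOnFinite_symm [Fintype ι] {P : ι → ℝ} :
    IsLaw (Finsupp.equivFunOnFinite.symm P) ↔ P ∈ stdSimplex ℝ ι := by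
  have mass_eq : Finsupp.linearCombination ℝ (fun _ => (1 : ℝ))
      (Finsupp.equivFunOnFinite.symm P) = ∑ i, P i := by
    rw [linearCombination_eq_sum (Finset.subset_univ _)]
    simp only [Finsupp.equivFunOnFinite_symm_apply_apply, mul_one]
  exact ⟨fun h => ⟨h.nonneg, mass_eq ▸ h.mass_eq_one⟩, fun h => ⟨h.1, mass_eq.trans h.2⟩⟩

lemma convex_setOf_isLaw : Convex ℝ {p : ι →₀ ℝ | IsLaw p} :=
  fun p hp q hq s t hs ht hst =>
    ⟨add_nonneg (smul_nonneg hs hp.nonneg) (smul_nonneg ht hq.nonneg), by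
      rw [map_add, map_smul, map_smul, hp.mass_eq_one, hq.mass_eq_one, smul_eq_mul, smul_eq_mul,
        mul_one, mul_one, hst]⟩

lemma IsLaw.sum_eq_one {p : ι →₀ ℝ} (hp : IsLaw p) {s : Finset ι} (hs : p.support ⊆ s) :
    ∑ i ∈ s, p i = 1 := by
  simpa only [linearCombination_eq_sum hs, mul_one] using hp.mass_eq_one

lemma IsLaw.linearCombination {p : ι →₀ ℝ} (hp : IsLaw p) {k : ι → κ →₀ ℝ}
    (hk : ∀ i, IsLaw (k i)) : IsLaw (Finsupp.linearCombination ℝ k p) := by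
  rw [Finsupp.linearCombination_apply]
  exact convex_setOf_isLaw.sum_mem (fun i _ => hp.nonneg i) (hp.sum_eq_one subset_rfl)
    fun i _ => hk i

lemma IsLaw.linearCombination_const {p : ι →₀ ℝ} (hp : IsLaw p) (c : ℝ) :
    Finsupp.linearCombination ℝ (fun _ => c) p = c := by
  rw [Finsupp.linearCombination_apply, Finsupp.sum, ← Finset.sum_smul, hp.sum_eq_one subset_rfl,
    one_smul]

lemma linearCombination_le_linearCombination {p : ι →₀ ℝ} (hp : 0 ≤ p) {f g : ι → ℝ}
    (hfg : ∀ i ∈ p.support, f i ≤ g i) :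
    Finsupp.linearCombination ℝ f p ≤ Finsupp.linearCombination ℝ g p := by
  rw [Finsupp.linearCombination_apply, Finsupp.linearCombination_apply]
  exact Finset.sum_le_sum fun i hi => mul_le_mul_of_nonneg_left (hfg i hi) (hp i)

lemma IsLaw.mapDomain {p : ι →₀ ℝ} (hp : IsLaw p) (f : ι → κ) : IsLaw (p.mapDomain f) :=
  ⟨Finsupp.mapDomain_nonneg hp.nonneg, by
    rw [Finsupp.linearCombination_mapDomain]
    exact hp.mass_eq_one⟩

/-- The joint law of independent draws from `p` and `q`. -/
def prodLaw (p : ι →₀ ℝ) (q : κ →₀ ℝ) : ι × κ →₀ ℝ :=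
  Finsupp.linearCombination ℝ (fun i => q.mapDomain (Prod.mk i)) p

lemma prodLaw_apply (p : ι →₀ ℝ) (q : κ →₀ ℝ) (z : ι × κ) : prodLaw p q z = p z.1 * q z.2 := by
  rw [prodLaw, Finsupp.linearCombination_apply, Finsupp.sum_apply, Finsupp.sum,
    Finset.sum_eq_single z.1]
  · exact congrArg (p z.1 * ·) (Finsupp.mapDomain_apply (Prod.mk_right_injective z.1) q z.2)
  · intro i _ hi
    have notMem_range : z ∉ Set.range (Prod.mk i : κ → ι × κ) := by
      rintro ⟨j, rfl⟩
      exact hi rfl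
    rw [Finsupp.smul_apply, Finsupp.mapDomain_of_notMem_range _ _ notMem_range, smul_zero]
  · intro hz
    rw [Finsupp.notMem_support_iff.1 hz, zero_smul, Finsupp.zero_apply]

lemma support_prodLaw_subset (p : ι →₀ ℝ) (q : κ →₀ ℝ) :
    (prodLaw p q).support ⊆ p.support ×ˢ q.support := fun z hz => by
  rw [Finsupp.mem_support_iff, prodLaw_apply] at hz
  exact Finset.mem_product.2 ⟨Finsupp.mem_support_iff.2 (left_ne_zero_of_mul hz),
    Finsupp.mem_support_iff.2 (right_ne_zero_of_mul hz)⟩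

lemma mapDomain_linearCombination (f : κ → μ) (k : ι → κ →₀ ℝ) (p : ι →₀ ℝ) :
    (Finsupp.linearCombination ℝ k p).mapDomain f =
      Finsupp.linearCombination ℝ (fun i => (k i).mapDomain f) p :=
  Finsupp.apply_linearCombination ℝ (Finsupp.lmapDomain ℝ ℝ f) k p

lemma mapDomain_prodLaw (p : ι →₀ ℝ) (q : κ →₀ ℝ) (f : ι × κ → μ) :
    (prodLaw p q).mapDomain f =
      Finsupp.linearCombination ℝ (fun i => q.mapDomain fun j => f (i, j)) p := by
  simp only [prodLaw, mapDomain_linearCombination, ← Finsupp.mapDomain_comp]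
  rfl

lemma IsLaw.prodLaw {p : ι →₀ ℝ} {q : κ →₀ ℝ} (hp : IsLaw p) (hq : IsLaw q) :
    IsLaw (prodLaw p q) :=
  hp.linearCombination fun i => hq.mapDomain (Prod.mk i)

lemma mapDomain_apply_eq_sum_of_support_subset [DecidableEq κ] {p : ι →₀ ℝ} {s : Finset ι}
    (hs : p.support ⊆ s) (f : ι → κ) (k : κ) :
    p.mapDomain f k = ∑ i ∈ s with f i = k, p i := by
  rw [Finsupp.mapDomain, Finsupp.sum_apply,
    Finsupp.sum_of_support_subset _ hs _ fun i _ => by simp, Finset.sum_filter]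
  exact Finset.sum_congr rfl fun i _ => Finsupp.single_apply

lemma mapDomain_apply_eq_zero_iff_of_nonneg {p : ι →₀ ℝ} (hp : 0 ≤ p) {f : ι → κ} {k : κ} :
    p.mapDomain f k = 0 ↔ ∀ i, f i = k → p i = 0 := by
  classical
  rw [mapDomain_apply_eq_sum_of_support_subset subset_rfl,
    Finset.sum_eq_zero_iff_of_nonneg fun i _ => hp i]
  refine ⟨fun h i hi => ?_, fun h i hi => h i (Finset.mem_filter.1 hi).2⟩
  by_contra hpi
  exact hpi (h i (Finset.mem_filter.2 ⟨Finsupp.mem_support_iff.2 hpi, hi⟩))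

/-- Absolute continuity of `p` with respect to the weights `q`. -/
def AbsCont (p : ι →₀ ℝ) (q : ι → ℝ) : Prop := ∀ i, q i = 0 → p i = 0

lemma absCont_of_pos (p : ι →₀ ℝ) {q : ι → ℝ} (hq : ∀ i, 0 < q i) : AbsCont p q :=
  fun i hi => absurd hi (hq i).ne'

lemma AbsCont.support_subset {p q : ι →₀ ℝ} (h : AbsCont p q) : p.support ⊆ q.support :=
  fun i hi => Finsupp.mem_support_iff.2 (mt (h i) (Finsupp.mem_support_iff.1 hi))

lemma AbsCont.prodLaw {p q : ι →₀ ℝ} {p' q' : κ →₀ ℝ} (h : AbsCont p q) (h' : AbsCont p' q') :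
    AbsCont (prodLaw p p') (prodLaw q q') := fun z hz => by
  rw [prodLaw_apply] at hz ⊢
  exact mul_eq_zero.2 ((mul_eq_zero.1 hz).imp (h z.1) (h' z.2))

lemma AbsCont.mapDomain {p q : ι →₀ ℝ} (h : AbsCont p q) (hp : 0 ≤ p) (hq : 0 ≤ q) (f : ι → κ) :
    AbsCont (p.mapDomain f) (q.mapDomain f) := fun _ hk =>
  (mapDomain_apply_eq_zero_iff_of_nonneg hp).2 fun i hi =>
    h i ((mapDomain_apply_eq_zero_iff_of_nonneg hq).1 hk i hi)

/-- The relative entropy `D(p ‖ q)`, in nats, of a finitely supported `p` with respect to weights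
`q`. It is meaningful only if `p` is absolutely continuous with respect to `q`. -/
def relEntropy (p : ι →₀ ℝ) (q : ι → ℝ) : ℝ := p.sum fun i a => klTerm a (q i)

lemma relEntropy_eq_sum {p : ι →₀ ℝ} {s : Finset ι} (hs : p.support ⊆ s) (q : ι → ℝ) :
    relEntropy p q = ∑ i ∈ s, klTerm (p i) (q i) :=
  Finsupp.sum_of_support_subset _ hs _ fun i _ => klTerm_zero_left (q i)

lemma relEntropy_eq_linearCombination (p : ι →₀ ℝ) (q : ι → ℝ) :
    relEntropy p q = Finsupp.linearCombination ℝ (fun i => Real.log (p i / q i)) p := rfl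

lemma linearCombination_log_add_one_sub_le_relEntropy {p : ι →₀ ℝ} (hp : IsLaw p) {q : ι → ℝ}
    {s : Finset ι} (hs : p.support ⊆ s) (hq : ∀ i ∈ s, 0 ≤ q i) (hpq : AbsCont p q)
    {t : ι → ℝ} (ht : ∀ i, 0 < t i) :
    Finsupp.linearCombination ℝ (fun i => Real.log (t i)) p + 1 - ∑ i ∈ s, q i * t i ≤
      relEntropy p q := by
  rw [relEntropy_eq_sum hs, linearCombination_eq_sum hs, ← hp.sum_eq_one hs,
    ← Finset.sum_add_distrib, ← Finset.sum_sub_distrib]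
  exact Finset.sum_le_sum fun i hi =>
    mul_log_add_sub_mul_le_klTerm (hp.nonneg i) (hq i hi) (hpq i) (ht i)

lemma relEntropy_nonneg {p : ι →₀ ℝ} (hp : IsLaw p) {q : ι → ℝ} {s : Finset ι}
    (hs : p.support ⊆ s) (hq : ∀ i ∈ s, 0 ≤ q i) (hpq : AbsCont p q)
    (hq1 : ∑ i ∈ s, q i ≤ 1) : 0 ≤ relEntropy p q := by
  have key := linearCombination_log_add_one_sub_le_relEntropy hp hs hq hpq fun _ => one_pos
  simp only [hp.linearCombination_const, Real.log_one, mul_one] at key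
  linarith

lemma convexOn_relEntropy (q : ι → ℝ) :
    ConvexOn ℝ (Set.Ici 0) fun p : ι →₀ ℝ => relEntropy p q := by
  classical
  refine ⟨convex_Ici 0, fun p hp p' hp' s t hs ht hst => ?_⟩
  have support_le : (s • p + t • p').support ⊆ p.support ∪ p'.support :=
    Finsupp.support_add.trans
      (Finset.union_subset_union Finsupp.support_smul Finsupp.support_smul)
  simp only [relEntropy_eq_sum support_le,
    relEntropy_eq_sum (Finset.subset_union_left (s₁ := p.support) (s₂ := p'.support)),
    relEntropy_eq_sum (Finset.subset_union_right (s₁ := p.support) (s₂ := p'.support)),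
    Finset.smul_sum, ← Finset.sum_add_distrib]
  exact Finset.sum_le_sum fun i _ => (convexOn_klTerm (q i)).2 (hp i) (hp' i) hs ht hst

lemma relEntropy_mapDomain_of_injective {f : ι → κ} (hf : Function.Injective f) (p : ι →₀ ℝ)
    (q : κ → ℝ) : relEntropy (p.mapDomain f) q = relEntropy p (q ∘ f) :=
  Finsupp.sum_mapDomain_index_inj hf

lemma relEntropy_eq_add_linearCombination_log {p : ι →₀ ℝ} {o q : ι → ℝ}
    (ho : AbsCont p o) (hq : AbsCont p q) :
    relEntropy p q =
      relEntropy p o + Finsupp.linearCombination ℝ (fun i => Real.log (o i / q i)) p := by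
  rw [relEntropy, relEntropy, Finsupp.linearCombination_apply, ← Finsupp.sum_add]
  refine Finsupp.sum_congr fun i hi => ?_
  have hi : p i ≠ 0 := Finsupp.mem_support_iff.1 hi
  have hoi : o i ≠ 0 := mt (ho i) hi
  have hqi : q i ≠ 0 := mt (hq i) hi
  rw [klTerm, klTerm, smul_eq_mul, ← mul_add, ← Real.log_mul (by positivity) (by positivity),
    div_mul_div_cancel₀ hoi]

lemma relEntropy_mapDomain_le {p q : ι →₀ ℝ} (hp : 0 ≤ p) (hq : 0 ≤ q)
    (hpq : AbsCont p q) (f : ι → κ) :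
    relEntropy (p.mapDomain f) (q.mapDomain f) ≤ relEntropy p q := by
  classical
  have hs : p.support ⊆ q.support := hpq.support_subset
  rw [relEntropy_eq_sum (Finsupp.mapDomain_support.trans (Finset.image_subset_image hs)),
    relEntropy_eq_sum hs,
    ← Finset.sum_fiberwise_of_maps_to (g := f) fun i hi => Finset.mem_image_of_mem f hi]
  refine Finset.sum_le_sum fun k _ => ?_
  rw [mapDomain_apply_eq_sum_of_support_subset hs,
    mapDomain_apply_eq_sum_of_support_subset subset_rfl]
  exact klTerm_sum_le_sum_klTerm _ (fun i _ => hp i) (fun i _ => hq i) fun i _ => hpq i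

lemma relEntropy_prodLaw {p : ι →₀ ℝ} {p' : κ →₀ ℝ} (hp : IsLaw p) (hp' : IsLaw p') {q : ι → ℝ}
    {q' : κ → ℝ} (hpq : AbsCont p q) (hpq' : AbsCont p' q') :
    relEntropy (prodLaw p p') (fun z => q z.1 * q' z.2) = relEntropy p q + relEntropy p' q' := by
  have sum_p := hp.sum_eq_one subset_rfl
  have sum_p' := hp'.sum_eq_one subset_rfl
  rw [relEntropy_eq_sum (support_prodLaw_subset p p'), Finset.sum_product,
    relEntropy_eq_sum subset_rfl, relEntropy_eq_sum subset_rfl]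
  simp only [prodLaw_apply, klTerm_mul_mul (hpq _) (hpq' _), Finset.sum_add_distrib,
    ← Finset.mul_sum, ← Finset.sum_mul, sum_p, sum_p', mul_one, one_mul]

lemma relEntropy_mul_const {p : ι →₀ ℝ} (hp : IsLaw p) {q : ι → ℝ}
    (hpq : AbsCont p q) {c : ℝ} (hc : c ≠ 0) :
    relEntropy p (fun i => q i * c) = relEntropy p q - Real.log c := by
  have klTerm_mul_const (i : ι) :
      klTerm (p i) (q i * c) = klTerm (p i) (q i) - p i * Real.log c := by
    simpa only [mul_one, klTerm, one_mul, one_div, Real.log_inv, mul_neg, ← sub_eq_add_neg] using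
      klTerm_mul_mul (a' := 1) (hpq i) fun h => absurd h hc
  simp only [relEntropy_eq_sum subset_rfl, klTerm_mul_const, Finset.sum_sub_distrib,
    ← Finset.sum_mul, hp.sum_eq_one subset_rfl, one_mul]

lemma relEntropy_one_nonpos {p : ι →₀ ℝ} (hp : IsLaw p) :
    relEntropy p (fun _ => 1) ≤ 0 := by
  rw [relEntropy_eq_sum subset_rfl]
  refine Finset.sum_nonpos fun i hi => ?_
  have le_one : p i ≤ 1 := hp.sum_eq_one subset_rfl ▸
    Finset.single_le_sum (fun j _ => hp.nonneg j) hi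
  rw [klTerm, div_one]
  exact Real.mul_log_nonpos (hp.nonneg i) le_one

end RelativeEntropy

section Channel

variable {A A' B B' C : Type*}

/-- The mutual information, in nats, of input and output of the channel with transition laws `W`,
for the input law `P`: the mean divergence of the transition laws from the output law. -/
def info (P : A →₀ ℝ) (W : A → B →₀ ℝ) : ℝ :=
  Finsupp.linearCombination ℝ (fun a => relEntropy (W a) (Finsupp.linearCombination ℝ W P)) P

/-- The transition laws of `W` are within divergence `r` of some positive weights, of total mass at
most one on a finite set carrying all transition laws. Such an `r` bounds the capacity. -/
def HasDivergenceRadiusLE (W : A → B →₀ ℝ) (r : ℝ) : Prop :=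
  ∃ (Q : B → ℝ) (s : Finset B), (∀ b, 0 < Q b) ∧ ∑ b ∈ s, Q b ≤ 1 ∧
    (∀ a, (W a).support ⊆ s) ∧ ∀ a, relEntropy (W a) Q ≤ r

variable {P : A →₀ ℝ} {W : A → B →₀ ℝ}

lemma absCont_linearCombination (hP : 0 ≤ P) (hW : ∀ a, IsLaw (W a)) {a : A}
    (ha : a ∈ P.support) : AbsCont (W a) (Finsupp.linearCombination ℝ W P) := fun b hb => by
  rw [Finsupp.linearCombination_apply, Finsupp.sum_apply] at hb
  have mul_eq_zero_of_mem := (Finset.sum_eq_zero_iff_of_nonneg fun a _ =>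
    mul_nonneg (hP a) ((hW a).nonneg b)).1 hb a ha
  exact (mul_eq_zero.1 mul_eq_zero_of_mem).resolve_left (Finsupp.mem_support_iff.1 ha)

lemma AbsCont.linearCombination {Q : B → ℝ} (h : ∀ a ∈ P.support, AbsCont (W a) Q) :
    AbsCont (Finsupp.linearCombination ℝ W P) Q := fun b hb => by
  rw [Finsupp.linearCombination_apply, Finsupp.sum_apply]
  exact Finset.sum_eq_zero fun a ha => mul_eq_zero_of_right _ (h a ha b hb)

lemma info_nonneg (hP : IsLaw P) (hW : ∀ a, IsLaw (W a)) : 0 ≤ info P W := by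
  have hO : IsLaw (Finsupp.linearCombination ℝ W P) := hP.linearCombination hW
  rw [← hP.linearCombination_const 0, info]
  refine linearCombination_le_linearCombination hP.nonneg fun a ha => ?_
  have hWO := absCont_linearCombination hP.nonneg hW ha
  exact relEntropy_nonneg (hW a) hWO.support_subset (fun b _ => hO.nonneg b) hWO
    (hO.sum_eq_one subset_rfl).le

lemma linearCombination_relEntropy_eq_info_add (hP : 0 ≤ P) (hW : ∀ a, IsLaw (W a)) {Q : B → ℝ}
    (hWQ : ∀ a ∈ P.support, AbsCont (W a) Q) :
    Finsupp.linearCombination ℝ (fun a => relEntropy (W a) Q) P =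
      info P W + relEntropy (Finsupp.linearCombination ℝ W P) Q := by
  set O := Finsupp.linearCombination ℝ W P with hO
  have relEntropy_eq (a : A) (ha : a ∈ P.support) : relEntropy (W a) Q = relEntropy (W a) O +
      Finsupp.linearCombination ℝ (fun b => Real.log (O b / Q b)) (W a) :=
    relEntropy_eq_add_linearCombination_log (absCont_linearCombination hP hW ha) (hWQ a ha)
  rw [relEntropy_eq_linearCombination O, hO, Finsupp.linearCombination_linearCombination, info,
    ← hO]
  simp only [Finsupp.linearCombination_apply _ P, ← Finsupp.sum_add, ← smul_add]
  exact Finsupp.sum_congr fun a ha => by rw [relEntropy_eq a ha]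

lemma support_linearCombination_subset {s : Finset B} (hs : ∀ a ∈ P.support, (W a).support ⊆ s) :
    (Finsupp.linearCombination ℝ W P).support ⊆ s := by
  classical
  exact Finsupp.support_sum.trans <| Finset.biUnion_subset.2 fun a ha =>
    Finsupp.support_smul.trans (hs a ha)

lemma info_le_linearCombination_relEntropy (hP : IsLaw P) (hW : ∀ a, IsLaw (W a)) {Q : B → ℝ}
    {s : Finset B} (hs : ∀ a ∈ P.support, (W a).support ⊆ s) (hQ : ∀ b ∈ s, 0 ≤ Q b)
    (hWQ : ∀ a ∈ P.support, AbsCont (W a) Q) (hQ1 : ∑ b ∈ s, Q b ≤ 1) :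
    info P W ≤ Finsupp.linearCombination ℝ (fun a => relEntropy (W a) Q) P := by
  rw [linearCombination_relEntropy_eq_info_add hP.nonneg hW hWQ]
  exact le_add_of_nonneg_right <| relEntropy_nonneg (hP.linearCombination hW)
    (support_linearCombination_subset hs) hQ (.linearCombination hWQ) hQ1

lemma HasDivergenceRadiusLE.mono {r r' : ℝ} (h : HasDivergenceRadiusLE W r) (hr : r ≤ r') :
    HasDivergenceRadiusLE W r' :=
  let ⟨Q, s, hQ, hQ1, hs, hQr⟩ := h
  ⟨Q, s, hQ, hQ1, hs, fun a => (hQr a).trans hr⟩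

lemma hasDivergenceRadiusLE_of_sum_le (hW : ∀ a, IsLaw (W a)) {Q : B → ℝ} (hQ : ∀ b, 0 < Q b)
    {s : Finset B} (hs : ∀ a, (W a).support ⊆ s) {N r : ℝ} (hN : 0 < N) (hQN : ∑ b ∈ s, Q b ≤ N)
    (hr : ∀ a, relEntropy (W a) Q ≤ r) : HasDivergenceRadiusLE W (r + Real.log N) := by
  refine ⟨fun b => Q b * N⁻¹, s, fun b => mul_pos (hQ b) (inv_pos.2 hN), ?_, hs, fun a => ?_⟩
  · rwa [← Finset.sum_mul, mul_inv_le_iff₀ hN, one_mul]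
  · rw [relEntropy_mul_const (hW a) (absCont_of_pos _ hQ) (inv_ne_zero hN.ne'), Real.log_inv,
      sub_neg_eq_add]
    exact add_le_add_left (hr a) _

lemma HasDivergenceRadiusLE.info_le {r : ℝ} (h : HasDivergenceRadiusLE W r) (hP : IsLaw P)
    (hW : ∀ a, IsLaw (W a)) : info P W ≤ r := by
  obtain ⟨Q, s, hQ, hQ1, hs, hr⟩ := h
  calc info P W ≤ Finsupp.linearCombination ℝ (fun a => relEntropy (W a) Q) P :=
        info_le_linearCombination_relEntropy hP hW (fun a _ => hs a) (fun b _ => (hQ b).le)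
          (fun a _ => absCont_of_pos (W a) hQ) hQ1
    _ ≤ Finsupp.linearCombination ℝ (fun _ => r) P :=
        linearCombination_le_linearCombination hP.nonneg fun a _ => hr a
    _ = r := hP.linearCombination_const r

lemma mem_support_mapDomain {p : A →₀ ℝ} (hp : 0 ≤ p) (f : A → B) {a : A} (ha : a ∈ p.support) :
    f a ∈ (p.mapDomain f).support :=
  Finsupp.mem_support_iff.2 fun h => Finsupp.mem_support_iff.1 ha <|
    (mapDomain_apply_eq_zero_iff_of_nonneg hp).1 h a rfl

lemma relEntropy_mapDomain_prodLaw_le {p q : B →₀ ℝ} {p' q' : B' →₀ ℝ} (hp : IsLaw p)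
    (hq : IsLaw q) (hp' : IsLaw p') (hq' : IsLaw q') (hpq : AbsCont p q) (hpq' : AbsCont p' q')
    (f : B × B' → C) :
    relEntropy ((prodLaw p p').mapDomain f) ((prodLaw q q').mapDomain f) ≤
      relEntropy p q + relEntropy p' q' := by
  rw [← relEntropy_prodLaw hp hp' hpq hpq']
  simpa only [← prodLaw_apply] using relEntropy_mapDomain_le (hp.prodLaw hp').nonneg
    (hq.prodLaw hq').nonneg (hpq.prodLaw hpq') f

lemma info_mapDomain_prodLaw_le {X : Type*} {P : X →₀ ℝ} (hP : IsLaw P) (hW : ∀ a, IsLaw (W a))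
    {W' : A' → B' →₀ ℝ} (hW' : ∀ a, IsLaw (W' a)) (f : B × B' → C) (π : X → A) (π' : X → A') :
    info P (fun x => (prodLaw (W (π x)) (W' (π' x))).mapDomain f) ≤
      info (P.mapDomain π) W + info (P.mapDomain π') W' := by
  set O := Finsupp.linearCombination ℝ W (P.mapDomain π) with hO
  set O' := Finsupp.linearCombination ℝ W' (P.mapDomain π') with hO'
  have law_O : IsLaw O := (hP.mapDomain π).linearCombination hW
  have law_O' : IsLaw O' := (hP.mapDomain π').linearCombination hW'
  have law_W (x : X) := (hW (π x)).prodLaw (hW' (π' x))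
  have law_out := (law_O.prodLaw law_O').mapDomain f
  have hWO (x : X) (hx : x ∈ P.support) : AbsCont (W (π x)) O :=
    absCont_linearCombination (hP.mapDomain π).nonneg hW (mem_support_mapDomain hP.nonneg π hx)
  have hWO' (x : X) (hx : x ∈ P.support) : AbsCont (W' (π' x)) O' :=
    absCont_linearCombination (hP.mapDomain π').nonneg hW' (mem_support_mapDomain hP.nonneg π' hx)
  have abs_cont_out (x : X) (hx : x ∈ P.support) :=
    ((hWO x hx).prodLaw (hWO' x hx)).mapDomain (law_W x).nonneg (law_O.prodLaw law_O').nonneg f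
  calc _ ≤ Finsupp.linearCombination ℝ (fun x => relEntropy
          ((prodLaw (W (π x)) (W' (π' x))).mapDomain f) ((prodLaw O O').mapDomain f)) P :=
        info_le_linearCombination_relEntropy hP (fun x => (law_W x).mapDomain f)
          (fun x hx => (abs_cont_out x hx).support_subset) (fun c _ => law_out.nonneg c)
          abs_cont_out (law_out.sum_eq_one subset_rfl).le
    _ ≤ Finsupp.linearCombination ℝ
          (fun x => relEntropy (W (π x)) O + relEntropy (W' (π' x)) O') P :=
        linearCombination_le_linearCombination hP.nonneg fun x hx =>
          relEntropy_mapDomain_prodLaw_le (hW (π x)) law_O (hW' (π' x)) law_O' (hWO x hx)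
            (hWO' x hx) f
    _ = info (P.mapDomain π) W + info (P.mapDomain π') W' := by
        simp only [info, Finsupp.linearCombination_mapDomain, Finsupp.linearCombination_apply _ P,
          ← Finsupp.sum_add, ← smul_add, Function.comp_apply, ← hO, ← hO']

/-- The failure probability of a code over the channel `W` with encoder `enc` and decoder `dec`, for
a message that is uniformly distributed over the finite type `ι`. -/
def codeFailureProb {ι : Type*} [Fintype ι] [DecidableEq ι] (W : A → B →₀ ℝ) (enc : ι → A)
    (dec : B → ι) : ℝ :=
  (∑ m, Finsupp.linearCombination ℝ (fun b => if dec b = m then (0 : ℝ) else 1) (W (enc m))) /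
    (Fintype.card ι : ℝ)

lemma sum_sum_mul_ite_le {ι : Type*} [Fintype ι] [DecidableEq ι] {Q : B → ℝ} {s : Finset B}
    (hQ : ∀ b ∈ s, 0 ≤ Q b) (hQ1 : ∑ b ∈ s, Q b ≤ 1) (dec : B → ι) :
    ∑ m, ∑ b ∈ s, Q b * (if dec b = m then (Fintype.card ι : ℝ) else 1) ≤
      2 * Fintype.card ι := by
  set M : ℝ := (Fintype.card ι : ℝ)
  have M_nonneg : 0 ≤ M := Nat.cast_nonneg _
  have sum_ite_le (b : B) : ∑ m, (if dec b = m then M else 1) ≤ 2 * M := by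
    calc ∑ m, (if dec b = m then M else 1)
        ≤ ∑ m, ((if dec b = m then M else 0) + 1) :=
          Finset.sum_le_sum fun m _ => by split_ifs <;> linarith
      _ = 2 * M := by
          rw [Finset.sum_add_distrib, Finset.sum_ite_eq, if_pos (Finset.mem_univ _),
            Finset.sum_const, Finset.card_univ, nsmul_one, two_mul]
  rw [Finset.sum_comm]
  calc ∑ b ∈ s, ∑ m, Q b * (if dec b = m then M else 1)
      ≤ ∑ b ∈ s, Q b * (2 * M) := Finset.sum_le_sum fun b hb => by
        rw [← Finset.mul_sum]
        exact mul_le_mul_of_nonneg_left (sum_ite_le b) (hQ b hb)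
    _ ≤ 2 * M := by
        rw [← Finset.sum_mul]
        exact mul_le_of_le_one_left (mul_nonneg zero_le_two M_nonneg) hQ1

lemma HasDivergenceRadiusLE.one_sub_codeFailureProb_mul_log_card_le {ι : Type*} [Fintype ι]
    [DecidableEq ι] [Nonempty ι] {r : ℝ} (h : HasDivergenceRadiusLE W r) (hW : ∀ a, IsLaw (W a))
    (enc : ι → A) (dec : B → ι) :
    (1 - codeFailureProb W enc dec) * Real.log (Fintype.card ι) ≤ r + 1 := by
  obtain ⟨Q, s, hQ, hQ1, hs, hr⟩ := h
  set M : ℝ := (Fintype.card ι : ℝ) with hM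
  have hM0 : 0 < M := Nat.cast_pos.2 Fintype.card_pos
  set e : ι → ℝ := fun m =>
    Finsupp.linearCombination ℝ (fun b => if dec b = m then (0 : ℝ) else 1) (W (enc m)) with he
  have log_ite (m : ι) (b : B) : Real.log (if dec b = m then M else 1) =
      Real.log M - (if dec b = m then 0 else 1) * Real.log M := by
    split_ifs <;> simp only [zero_mul, sub_zero, one_mul, sub_self, Real.log_one]
  -- Fano's argument is Gibbs' inequality against the weights that favour the outputs decoded to
  -- `m` by a factor `M`.
  have gibbs (m : ι) :
      (1 - e m) * Real.log M + 1 - ∑ b ∈ s, Q b * (if dec b = m then M else 1) ≤ r := by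
    have key := linearCombination_log_add_one_sub_le_relEntropy (hW (enc m)) (hs (enc m))
      (fun b _ => (hQ b).le) (absCont_of_pos _ hQ) (t := fun b => if dec b = m then M else 1)
      fun b => by split_ifs <;> positivity
    simp only [log_ite, Finsupp.linearCombination_apply, Finsupp.sum, smul_eq_mul, mul_sub,
      Finset.sum_sub_distrib, ← mul_assoc, ← Finset.sum_mul,
      (hW (enc m)).sum_eq_one subset_rfl] at key
    simp only [he, Finsupp.linearCombination_apply, Finsupp.sum, smul_eq_mul, sub_mul]
    exact key.trans (hr (enc m))
  have sum_weights := sum_sum_mul_ite_le (fun b (_ : b ∈ s) => (hQ b).le) hQ1 dec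
  have sum_gibbs := Finset.sum_le_sum fun m (_ : m ∈ Finset.univ) => gibbs m
  simp only [Finset.sum_sub_distrib, Finset.sum_add_distrib, ← Finset.sum_mul, Finset.sum_const,
    Finset.card_univ, nsmul_eq_mul, mul_one, ← hM] at sum_gibbs
  refine le_of_mul_le_mul_left ?_ hM0
  calc M * ((1 - codeFailureProb W enc dec) * Real.log M)
      = (M - ∑ m, e m) * Real.log M := by
        rw [codeFailureProb, ← mul_assoc, mul_sub, mul_one, mul_div_cancel₀ _ hM0.ne']
    _ ≤ M * (r + 1) := by linarith

end Channel

section DeletionLaw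

variable {α : Type*} {d : ℝ}

/-- The strings of length at most `n`. -/
def stringsLE (α : Type*) [Fintype α] (n : ℕ) : Finset (List α) :=
  (List.finite_length_le α n).toFinset

lemma mem_stringsLE [Fintype α] {n : ℕ} {y : List α} : y ∈ stringsLE α n ↔ y.length ≤ n :=
  Set.Finite.mem_toFinset _

lemma stringsLE_zero [Fintype α] : stringsLE α 0 = {[]} := by
  ext
  simp [mem_stringsLE]

lemma sum_stringsLE_succ [Fintype α] {M : Type*} [AddCommMonoid M] (n : ℕ) (f : List α → M) :
    ∑ y ∈ stringsLE α (n + 1), f y = f [] + ∑ a, ∑ y ∈ stringsLE α n, f (a :: y) := by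
  classical
  have stringsLE_succ : stringsLE α (n + 1) =
      insert [] ((Finset.univ ×ˢ stringsLE α n).image fun z => z.1 :: z.2) := by
    ext (_ | ⟨a, y⟩) <;> simp [mem_stringsLE]
  rw [stringsLE_succ, Finset.sum_insert (by simp), Finset.sum_image (by grind [Set.InjOn]),
    Finset.sum_product]

lemma card_stringsLE_bool_le (n : ℕ) : (stringsLE Bool n).card ≤ 2 ^ (n + 1) := by
  suffices (stringsLE Bool n).card + 1 = 2 ^ (n + 1) by lia
  induction n with
  | zero => rw [stringsLE_zero, Finset.card_singleton, zero_add, pow_one]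
  | succ n ih =>
    rw [Finset.card_eq_sum_ones, sum_stringsLE_succ, pow_succ, ← ih, ← Finset.card_eq_sum_ones]
    simp only [Finset.sum_const, Finset.card_univ, Fintype.card_bool, smul_eq_mul]
    lia

/-- Sending the letter `a` before a transmission: `a` is deleted with probability `d`, and otherwise
prepended to the received string. This operator acts on the law of the received string. -/
def sendLetter (d : ℝ) (a : α) : Module.End ℝ (List α →₀ ℝ) :=
  d • 1 + (1 - d) • Finsupp.lmapDomain ℝ ℝ (List.cons a)

lemma sendLetter_apply (d : ℝ) (a : α) (ν : List α →₀ ℝ) :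
    sendLetter d a ν = d • ν + (1 - d) • ν.mapDomain (List.cons a) := rfl

lemma IsLaw.sendLetter {ν : List α →₀ ℝ} (hν : IsLaw ν) (h0 : 0 ≤ d) (h1 : d ≤ 1) (a : α) :
    IsLaw (sendLetter d a ν) :=
  convex_setOf_isLaw hν (hν.mapDomain _) h0 (sub_nonneg.2 h1) (add_sub_cancel d 1)

lemma IsLaw.sendLetter_pow {ν : List α →₀ ℝ} (hν : IsLaw ν) (h0 : 0 ≤ d) (h1 : d ≤ 1) (a : α)
    (k : ℕ) : IsLaw ((DeletionChannel.sendLetter d a ^ k) ν) := by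
  induction k with
  | zero => exact hν
  | succ k ih =>
    rw [pow_succ']
    exact ih.sendLetter h0 h1 a

/-- The law of the string received when the string `x` is sent. -/
def law (d : ℝ) : List α → List α →₀ ℝ
  | [] => Finsupp.single [] 1
  | a :: x => sendLetter d a (law d x)

lemma law_cons (d : ℝ) (a : α) (x : List α) : law d (a :: x) = sendLetter d a (law d x) := rfl

lemma isLaw_law (h0 : 0 ≤ d) (h1 : d ≤ 1) (x : List α) : IsLaw (law d x) := by
  induction x with
  | nil => exact isLaw_single []
  | cons a x ih => exact ih.sendLetter h0 h1 a

lemma length_le_of_mem_support_law {x y : List α} (hy : y ∈ (law d x).support) :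
    y.length ≤ x.length := by
  classical
  induction x generalizing y with
  | nil =>
    rw [Finset.mem_singleton.1 (Finsupp.support_single_subset hy)]
  | cons a x ih =>
    rw [law_cons, sendLetter_apply] at hy
    rcases Finset.mem_union.1 (Finsupp.support_add hy) with h | h
    · exact (ih (Finsupp.support_smul h)).trans (Nat.le_succ _)
    · obtain ⟨z, hz, rfl⟩ := Finset.mem_image.1
        (Finsupp.mapDomain_support (Finsupp.support_smul h))
      exact Nat.succ_le_succ (ih hz)

lemma support_law_subset [Fintype α] {n : ℕ} {x : List α} (hx : x.length ≤ n) :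
    (law d x).support ⊆ stringsLE α n :=
  fun _ hy => mem_stringsLE.2 ((length_le_of_mem_support_law hy).trans hx)

lemma law_append (d : ℝ) (x x' : List α) :
    law d (x ++ x') = (prodLaw (law d x) (law d x')).mapDomain fun z => z.1 ++ z.2 := by
  rw [mapDomain_prodLaw]
  induction x with
  | nil =>
    simp only [law, List.nil_append, Finsupp.linearCombination_single, one_smul]
    exact Finsupp.mapDomain_id.symm
  | cons a x ih =>
    rw [List.cons_append, law_cons, law_cons, ih, sendLetter_apply, sendLetter_apply, map_add,
      map_smul, map_smul, Finsupp.linearCombination_mapDomain, mapDomain_linearCombination]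
    simp only [← Finsupp.mapDomain_comp]
    rfl

lemma sum_finset_fin_succ {M : Type*} [AddCommMonoid M] {n : ℕ} (f : Finset (Fin (n + 1)) → M) :
    ∑ S, f S = ∑ T : Finset (Fin n), f (T.map (Fin.succEmb n)) +
      ∑ T : Finset (Fin n), f (insert 0 (T.map (Fin.succEmb n))) := by
  have univ_eq : (Finset.univ : Finset (Finset (Fin (n + 1)))) =
      (insert 0 ((Finset.univ : Finset (Fin n)).map (Fin.succEmb n))).powerset := by
    rw [← Finset.powerset_univ, Fin.univ_succ, Finset.cons_eq_insert]
    rfl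
  have powerset_map : ((Finset.univ : Finset (Fin n)).map (Fin.succEmb n)).powerset =
      (Finset.univ : Finset (Finset (Fin n))).map
        (Finset.mapEmbedding (Fin.succEmb n)).toEmbedding := by
    ext S
    simp only [Finset.mem_powerset, Finset.mem_map, Finset.mem_univ, true_and,
      Finset.subset_map_iff, Finset.subset_univ]
    simp [eq_comm]
  rw [univ_eq, Finset.sum_powerset_insert (by simp), powerset_map, Finset.sum_map, Finset.sum_map]
  rfl

lemma received_map_succ {n : ℕ} (x : Fin (n + 1) → Bool) (T : Finset (Fin n)) :
    received x (T.map (Fin.succEmb n)) = received (fun i => x i.succ) T := by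
  simp [received, List.finRange_succ, List.filter_map, Function.comp_def]

lemma received_insert_zero {n : ℕ} (x : Fin (n + 1) → Bool) (T : Finset (Fin n)) :
    received x (insert 0 (T.map (Fin.succEmb n))) = x 0 :: received (fun i => x i.succ) T := by
  simp [received, List.finRange_succ, List.filter_map, Function.comp_def]

lemma survivalProb_map_succ (d : ℝ) {n : ℕ} (T : Finset (Fin n)) :
    survivalProb d (T.map (Fin.succEmb n)) = d * survivalProb d T := by
  have card_le : T.card ≤ n := by simpa using T.card_le_univ
  rw [survivalProb, survivalProb, Finset.card_map, Nat.succ_sub card_le, pow_succ]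
  ring

lemma survivalProb_insert_zero (d : ℝ) {n : ℕ} (T : Finset (Fin n)) :
    survivalProb d (insert 0 (T.map (Fin.succEmb n))) = (1 - d) * survivalProb d T := by
  rw [survivalProb, survivalProb, Finset.card_insert_of_notMem (by simp), Finset.card_map,
    Nat.add_sub_add_right, pow_succ]
  ring

lemma sum_survivalProb_mul (d : ℝ) {n : ℕ} (x : Fin n → Bool) (f : List Bool → ℝ) :
    ∑ S, survivalProb d S * f (received x S) =
      Finsupp.linearCombination ℝ f (law d (List.ofFn x)) := by
  induction n generalizing f with
  | zero =>
    rw [Fintype.sum_unique, Finset.eq_empty_of_isEmpty default, List.ofFn_zero, law,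
      Finsupp.linearCombination_single]
    simp [survivalProb, received]
  | succ n ih =>
    simp only [sum_finset_fin_succ, received_map_succ, received_insert_zero,
      survivalProb_map_succ, survivalProb_insert_zero, mul_assoc, ← Finset.mul_sum]
    rw [ih (fun i => x i.succ), ih (fun i => x i.succ) fun y => f (x 0 :: y), List.ofFn_succ,
      law_cons, sendLetter_apply, map_add, map_smul, map_smul, Finsupp.linearCombination_mapDomain]
    rfl

/-- The channel of `n` uses of the deletion channel. -/
def blockLaw (d : ℝ) (n : ℕ) (x : Fin n → Bool) : List Bool →₀ ℝ := law d (List.ofFn x)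

lemma transition_eq_blockLaw (d : ℝ) {n : ℕ} (x : Fin n → Bool) (y : List Bool) :
    transition d x y = blockLaw d n x y := by
  have key := sum_survivalProb_mul d x fun z => if z = y then 1 else 0
  simp only [mul_ite, mul_one, mul_zero] at key
  rw [transition, key, blockLaw, Finsupp.linearCombination_apply]
  simp only [smul_eq_mul, mul_ite, mul_one, mul_zero]
  exact Finsupp.sum_ite_self_eq' _ _

lemma transition_eq_zero (d : ℝ) {n : ℕ} (x : Fin n → Bool) {y : List Bool}
    (hy : y ∉ outputs n) : transition d x y = 0 :=
  Finset.sum_eq_zero fun S _ => if_neg fun h =>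
    hy (Finset.mem_image.2 ⟨(x, S), Finset.mem_univ _, h⟩)

lemma support_blockLaw_subset (d : ℝ) {n : ℕ} (x : Fin n → Bool) :
    (blockLaw d n x).support ⊆ outputs n := fun y hy => by
  rw [Finsupp.mem_support_iff, ← transition_eq_blockLaw] at hy
  exact not_not.1 (mt (transition_eq_zero d x) hy)

lemma failureProb_eq_codeFailureProb (d : ℝ) {n M : ℕ} (enc : Fin M → Fin n → Bool)
    (dec : List Bool → Fin M) :
    failureProb d enc dec = codeFailureProb (blockLaw d n) enc dec := by
  simp only [failureProb, blockLaw, codeFailureProb, ← sum_survivalProb_mul, mul_ite, mul_zero,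
    mul_one, Fintype.card_fin]

end DeletionLaw

section RunLength

lemma ascPochhammer_eval_one_half (n : ℕ) :
    (ascPochhammer ℝ n).eval (1 / 2) = n.factorial * (n.centralBinom / 4 ^ n) := by
  induction n with
  | zero => simp
  | succ n ih =>
    have succ_mul_centralBinom : ((n : ℝ) + 1) * (n + 1).centralBinom =
        2 * (2 * n + 1) * n.centralBinom := mod_cast Nat.succ_mul_centralBinom_succ n
    rw [ascPochhammer_succ_eval, ih, Nat.factorial_succ, Nat.cast_mul, Nat.cast_succ, pow_succ]
    linear_combination -(n.factorial / 4 ^ n / 4 : ℝ) * succ_mul_centralBinom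

lemma multichoose_one_half (n : ℕ) : Ring.multichoose (1 / 2 : ℝ) n = n.centralBinom / 4 ^ n := by
  refine mul_left_cancel₀ (Nat.cast_ne_zero.2 n.factorial_ne_zero) ?_
  rw [← nsmul_eq_mul, Ring.factorial_nsmul_multichoose_eq_ascPochhammer,
    Polynomial.ascPochhammer_smeval_eq_eval, ascPochhammer_eval_one_half]

lemma hasSum_centralBinom_mul_pow {t : ℝ} (ht : |t| < 1) :
    HasSum (fun r : ℕ => (r.centralBinom : ℝ) * (t / 4) ^ r) (√(1 - t))⁻¹ := by
  have key : HasSum (fun r : ℕ => Ring.choose (1 / 2 + r - 1 : ℝ) r • t ^ r)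
      (1 / (1 - t) ^ (1 / 2 : ℝ)) := by
    simpa only [FormalMultilinearSeries.ofScalars_apply_eq, zero_add] using
      (Real.one_div_one_sub_rpow_hasFPowerSeriesOnBall_zero (1 / 2)).hasSum (y := t)
        (by simpa [enorm_eq_nnnorm, ← NNReal.coe_lt_coe] using ht)
  rw [← Real.sqrt_eq_rpow, one_div √(1 - t)] at key
  refine key.congr_fun fun r => ?_
  rw [Ring.choose, sub_right_comm, sub_add_cancel, add_sub_cancel_right, multichoose_one_half,
    div_pow, smul_eq_mul, div_mul_eq_mul_div, mul_div_assoc]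

/-- The weight `√(1 - q) C(2r, r) (q / 4) ^ r` of a run of length `r` under the reference law, where
`q = √(1 - q) = 1 / φ`. -/
def runWeight (r : ℕ) : ℝ :=
  Real.goldenRatio⁻¹ * (r.centralBinom * (Real.goldenRatio⁻¹ / 4) ^ r)

lemma runWeight_pos (r : ℕ) : 0 < runWeight r := by
  have := Real.goldenRatio_pos
  have := r.centralBinom_pos
  unfold runWeight
  positivity

lemma one_sub_inv_goldenRatio : 1 - Real.goldenRatio⁻¹ = Real.goldenRatio⁻¹ ^ 2 := by
  rw [Real.inv_goldenRatio, neg_sq, Real.goldenConj_sq]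
  ring

lemma hasSum_runWeight : HasSum runWeight 1 := by
  have inv_pos : 0 < Real.goldenRatio⁻¹ := inv_pos.2 Real.goldenRatio_pos
  have key := (hasSum_centralBinom_mul_pow (abs_lt.2 ⟨by linarith,
    inv_lt_one_of_one_lt₀ Real.one_lt_goldenRatio⟩)).mul_left Real.goldenRatio⁻¹
  rwa [one_sub_inv_goldenRatio, Real.sqrt_sq inv_pos.le, mul_inv_cancel₀ inv_pos.ne'] at key

lemma sum_runWeight_le_one (s : Finset ℕ) : ∑ r ∈ s, runWeight r ≤ 1 :=
  sum_le_hasSum s (fun r _ => (runWeight_pos r).le) hasSum_runWeight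

lemma log_runWeight (r : ℕ) : Real.log (runWeight r) =
    Real.log ((2 * r).factorial) - 2 * Real.log r.factorial
      - r * (2 * Real.log 2 + Real.log Real.goldenRatio) - Real.log Real.goldenRatio := by
  have := Real.goldenRatio_pos
  have centralBinom_eq :
      (r.centralBinom : ℝ) = (2 * r).factorial / (r.factorial * r.factorial) := by
    rw [Nat.centralBinom_eq_two_mul_choose, two_mul, Nat.cast_add_choose]
  have log_four : Real.log 4 = 2 * Real.log 2 := by
    rw [show (4 : ℝ) = 2 ^ 2 by norm_num, Real.log_pow, Nat.cast_ofNat]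
  rw [runWeight, centralBinom_eq, Real.log_mul (by positivity) (by positivity),
    Real.log_mul (by positivity) (by positivity), Real.log_div (by positivity) (by positivity),
    Real.log_mul (by positivity) (by positivity), Real.log_pow,
    Real.log_div (by positivity) (by positivity), Real.log_inv, log_four]
  ring

/-- The binomial law with `k` fair trials. -/
def fairBinom : ℕ → ℕ →₀ ℝ
  | 0 => Finsupp.single 0 1
  | k + 1 => (1 / 2 : ℝ) • fairBinom k + (1 / 2 : ℝ) • (fairBinom k).mapDomain Nat.succ

lemma isLaw_fairBinom (k : ℕ) : IsLaw (fairBinom k) := by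
  induction k with
  | zero => exact isLaw_single 0
  | succ k ih =>
    exact convex_setOf_isLaw ih (ih.mapDomain _) (by norm_num) (by norm_num) (by norm_num)

lemma fairBinom_apply (k r : ℕ) : fairBinom k r = k.choose r / 2 ^ k := by
  induction k generalizing r with
  | zero => cases r <;> simp [fairBinom]
  | succ k ih =>
    rw [fairBinom, Finsupp.add_apply, Finsupp.smul_apply, Finsupp.smul_apply, pow_succ]
    cases r with
    | zero =>
      rw [Finsupp.mapDomain_of_notMem_range _ _ (by simp), ih, Nat.choose_zero_right,
        Nat.choose_zero_right, smul_zero, smul_eq_mul]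
      ring
    | succ r =>
      rw [Finsupp.mapDomain_apply Nat.succ_injective, ih, ih, Nat.choose_succ_succ, Nat.cast_add,
        smul_eq_mul, smul_eq_mul]
      ring

lemma support_fairBinom_subset (k : ℕ) : (fairBinom k).support ⊆ Finset.range (k + 1) :=
  fun r hr => by
    rw [Finsupp.mem_support_iff, fairBinom_apply] at hr
    by_contra hrk
    exact hr (by rw [Nat.choose_eq_zero_of_lt (by simpa using hrk), Nat.cast_zero, zero_div])

lemma sum_fairBinom_mul_cast (k : ℕ) :
    ∑ r ∈ Finset.range (k + 1), fairBinom k r * (r : ℝ) = k / 2 := by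
  rw [← linearCombination_eq_sum (support_fairBinom_subset k)]
  induction k with
  | zero => simp [fairBinom]
  | succ k ih =>
    have linearCombination_succ :
        Finsupp.linearCombination ℝ (fun r : ℕ => (r.succ : ℝ)) (fairBinom k) = k / 2 + 1 := by
      rw [← ih, ← (isLaw_fairBinom k).linearCombination_const 1]
      simp only [Finsupp.linearCombination_apply, ← Finsupp.sum_add, ← smul_add, Nat.cast_succ]
    rw [fairBinom, map_add, map_smul, map_smul, Finsupp.linearCombination_mapDomain, ih,
      Function.comp_def, linearCombination_succ, smul_eq_mul, smul_eq_mul, Nat.cast_succ]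
    ring

lemma sum_fairBinom_mul_reflect (k : ℕ) (f : ℕ → ℝ) :
    ∑ r ∈ Finset.range (k + 1), fairBinom k r * f (k - r) =
      ∑ r ∈ Finset.range (k + 1), fairBinom k r * f r := by
  rw [← Finset.sum_range_reflect]
  refine Finset.sum_congr rfl fun r hr => ?_
  have hr : r ≤ k := Finset.mem_range_succ_iff.1 hr
  rw [add_tsub_cancel_right, Nat.sub_sub_self hr, fairBinom_apply, fairBinom_apply,
    Nat.choose_symm hr]

lemma log_fairBinom {k r : ℕ} (hr : r ≤ k) : Real.log (fairBinom k r) =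
    Real.log k.factorial - Real.log r.factorial - Real.log (k - r).factorial
      - k * Real.log 2 := by
  rw [fairBinom_apply, Nat.cast_choose ℝ hr, Real.log_div (by positivity) (by positivity),
    Real.log_div (by positivity) (by positivity), Real.log_mul (by positivity) (by positivity),
    Real.log_pow]
  ring

lemma log_factorial_le_sum_fairBinom_mul (k : ℕ) :
    Real.log k.factorial ≤
      ∑ r ∈ Finset.range (k + 1), fairBinom k r * Real.log (2 * r).factorial := by
  have sum_eq_one := (isLaw_fairBinom k).sum_eq_one (support_fairBinom_subset k)
  have jensen := Real.convexOn_log_Gamma.map_sum_le (t := Finset.range (k + 1)) (w := fairBinom k)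
    (p := fun r => ((2 * r : ℕ) : ℝ) + 1) (fun r _ => (isLaw_fairBinom k).nonneg r) sum_eq_one
    (fun r _ => Set.mem_Ioi.2 (by positivity))
  have mean : ∑ r ∈ Finset.range (k + 1), fairBinom k r * (((2 * r : ℕ) : ℝ) + 1) = k + 1 := by
    simp only [mul_add, Finset.sum_add_distrib, mul_one, sum_eq_one, Nat.cast_mul,
      mul_left_comm _ ((2 : ℕ) : ℝ), ← Finset.mul_sum, sum_fairBinom_mul_cast]
    ring
  simp only [smul_eq_mul, Function.comp_apply, Real.Gamma_nat_eq_factorial, mean] at jensen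
  exact jensen

lemma relEntropy_fairBinom_runWeight_le (k : ℕ) :
    relEntropy (fairBinom k) runWeight ≤ Real.log Real.goldenRatio * (k / 2 + 1) := by
  set c := Real.log Real.goldenRatio
  have term (r : ℕ) (hr : r ∈ Finset.range (k + 1)) : klTerm (fairBinom k r) (runWeight r) =
      fairBinom k r * (Real.log k.factorial - k * Real.log 2 + c) +
        fairBinom k r * Real.log r.factorial - fairBinom k r * Real.log (k - r).factorial -
        fairBinom k r * Real.log (2 * r).factorial + fairBinom k r * r * (2 * Real.log 2 + c) := by
    rw [klTerm_eq_mul_log_sub fun h => absurd h (runWeight_pos r).ne', log_runWeight,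
      log_fairBinom (Finset.mem_range_succ_iff.1 hr)]
    ring
  rw [relEntropy_eq_sum (support_fairBinom_subset k), Finset.sum_congr rfl term]
  simp only [Finset.sum_add_distrib, Finset.sum_sub_distrib, ← Finset.sum_mul,
    (isLaw_fairBinom k).sum_eq_one (support_fairBinom_subset k), sum_fairBinom_mul_cast,
    sum_fairBinom_mul_reflect k fun r => Real.log r.factorial]
  linarith [log_factorial_le_sum_fairBinom_mul k]

end RunLength

section StringWeight

variable {α : Type*} {d : ℝ} {a b : α}

lemma sendLetter_half_pow (b : α) (k : ℕ) (ν : List α →₀ ℝ) :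
    (sendLetter (1 / 2) b ^ k) ν =
      (prodLaw (fairBinom k) ν).mapDomain fun z => List.replicate z.1 b ++ z.2 := by
  rw [mapDomain_prodLaw]
  induction k with
  | zero =>
    simp only [pow_zero, Module.End.one_apply, fairBinom, Finsupp.linearCombination_single,
      one_smul, List.replicate_zero, List.nil_append]
    exact Finsupp.mapDomain_id.symm
  | succ k ih =>
    rw [pow_succ', Module.End.mul_apply, ih, sendLetter_apply, sub_half, fairBinom, map_add,
      map_smul, map_smul, Finsupp.linearCombination_mapDomain, mapDomain_linearCombination]
    simp only [← Finsupp.mapDomain_comp]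
    rfl

lemma sendLetter_eq_add_sendLetter_half (d : ℝ) (a : α) :
    sendLetter d a = (2 * d - 1) • 1 + (2 * (1 - d)) • sendLetter (1 / 2) a := by
  simp only [sendLetter]
  module

/-- The product of the weights of the runs of a string, where a run of the letter `b`, possibly
empty, is taken to be in progress at the start and to have length `r` so far. -/
def stringWeight [DecidableEq α] : α → ℕ → List α → ℝ
  | _, r, [] => runWeight r
  | b, r, a :: y => if a = b then stringWeight b (r + 1) y else runWeight r * stringWeight a 0 y

lemma stringWeight_pos [DecidableEq α] (b : α) (r : ℕ) (y : List α) : 0 < stringWeight b r y := by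
  induction y generalizing b r with
  | nil => exact runWeight_pos r
  | cons a y ih =>
    rw [stringWeight]
    split_ifs
    exacts [ih b (r + 1), mul_pos (runWeight_pos r) (ih a 0)]

lemma sum_stringWeight_bool_le (n : ℕ) (b : Bool) (r : ℕ) :
    ∑ y ∈ stringsLE Bool n, stringWeight b r y ≤
      (n + 1) * ∑ j ∈ Finset.range (n + 1), runWeight (r + j) := by
  induction n generalizing b r with
  | zero => simp [stringsLE_zero, stringWeight]
  | succ n ih =>
    have sum_not : ∑ y ∈ stringsLE Bool n, stringWeight (!b) 0 y ≤ n + 1 :=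
      (ih (!b) 0).trans (mul_le_of_le_one_right (by positivity)
        (by simpa only [zero_add] using sum_runWeight_le_one _))
    have sum_letters : ∑ a, ∑ y ∈ stringsLE Bool n, stringWeight b r (a :: y) =
        ∑ y ∈ stringsLE Bool n, stringWeight b (r + 1) y +
          runWeight r * ∑ y ∈ stringsLE Bool n, stringWeight (!b) 0 y := by
      cases b <;> simp [stringWeight, Finset.mul_sum, add_comm]
    have sum_tail_nonneg : 0 ≤ ∑ j ∈ Finset.range (n + 1), runWeight (r + (j + 1)) :=
      Finset.sum_nonneg fun j _ => (runWeight_pos _).le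
    have sum_same := ih b (r + 1)
    have mul_sum_not := mul_le_mul_of_nonneg_left sum_not (runWeight_pos r).le
    simp only [add_assoc, add_comm 1] at sum_same
    rw [sum_stringsLE_succ, sum_letters, Finset.sum_range_succ', add_zero, stringWeight]
    push_cast
    linarith

lemma stringWeight_replicate [DecidableEq α] (b : α) (r j : ℕ) :
    stringWeight b r (List.replicate j b) = runWeight (r + j) := by
  induction j generalizing r with
  | zero => rfl
  | succ j ih => rw [List.replicate_succ, stringWeight, if_pos rfl, ih, Nat.succ_add_eq_add_succ]

lemma stringWeight_replicate_append_cons [DecidableEq α] (hab : a ≠ b) (r j : ℕ) (y : List α) :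
    stringWeight b r (List.replicate j b ++ a :: y) = runWeight (r + j) * stringWeight a 0 y := by
  induction j generalizing r with
  | zero => exact if_neg hab
  | succ j ih =>
    rw [List.replicate_succ, List.cons_append, stringWeight, if_pos rfl, ih,
      Nat.succ_add_eq_add_succ]

lemma injective_replicate_append_cons (hab : a ≠ b) :
    Function.Injective fun z : ℕ × List α => List.replicate z.1 b ++ a :: z.2 := by
  rintro ⟨i, y⟩ ⟨j, z⟩ h
  induction i generalizing j with
  | zero => cases j <;> simp_all [List.replicate_succ]
  | succ i ih =>
    cases j with
    | zero => simp_all [List.replicate_succ, eq_comm]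
    | succ j => simpa using ih j (by simpa [List.replicate_succ] using h)

lemma relEntropy_sendLetter_half_pow_single_nil [DecidableEq α] (b : α) (k : ℕ) :
    relEntropy ((sendLetter (1 / 2) b ^ k) (Finsupp.single [] 1)) (stringWeight b 0) =
      relEntropy (fairBinom k) runWeight := by
  have eq_mapDomain : (sendLetter (1 / 2) b ^ k) (Finsupp.single [] 1) =
      (fairBinom k).mapDomain fun j => List.replicate j b := by
    rw [sendLetter_half_pow, mapDomain_prodLaw]
    simp [Finsupp.mapDomain, Finsupp.linearCombination_apply]
  rw [eq_mapDomain, relEntropy_mapDomain_of_injective (List.replicate_left_injective b)]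
  congr 1
  funext j
  rw [Function.comp_apply, stringWeight_replicate, zero_add]

lemma relEntropy_sendLetter_half_pow_mapDomain_cons [DecidableEq α] (hab : a ≠ b) (k : ℕ)
    {ν : List α →₀ ℝ} (hν : IsLaw ν) :
    relEntropy ((sendLetter (1 / 2) b ^ k) (ν.mapDomain (List.cons a))) (stringWeight b 0) =
      relEntropy (fairBinom k) runWeight + relEntropy ν (stringWeight a 0) := by
  have eq_mapDomain : (sendLetter (1 / 2) b ^ k) (ν.mapDomain (List.cons a)) =
      (prodLaw (fairBinom k) ν).mapDomain fun z => List.replicate z.1 b ++ a :: z.2 := by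
    simp only [sendLetter_half_pow, mapDomain_prodLaw, ← Finsupp.mapDomain_comp]
    rfl
  rw [eq_mapDomain, relEntropy_mapDomain_of_injective (injective_replicate_append_cons hab),
    ← relEntropy_prodLaw (isLaw_fairBinom k) hν (absCont_of_pos _ runWeight_pos)
      (absCont_of_pos _ (stringWeight_pos a 0))]
  congr 1
  funext z
  rw [Function.comp_apply, stringWeight_replicate_append_cons hab, zero_add]

lemma relEntropy_pow_sendLetter_self_le (h0 : 1 / 2 ≤ d) (h1 : d ≤ 1) (b : α) (k : ℕ)
    {ν : List α →₀ ℝ} (hν : IsLaw ν) (q : List α → ℝ) :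
    relEntropy ((sendLetter (1 / 2) b ^ k) (sendLetter d b ν)) q ≤
      (2 * d - 1) * relEntropy ((sendLetter (1 / 2) b ^ k) ν) q +
        2 * (1 - d) * relEntropy ((sendLetter (1 / 2) b ^ (k + 1)) ν) q := by
  have isLaw_pow (k : ℕ) := hν.sendLetter_pow (d := 1 / 2) (by norm_num) (by norm_num) b k
  rw [sendLetter_eq_add_sendLetter_half d, LinearMap.add_apply, LinearMap.smul_apply,
    LinearMap.smul_apply, map_add, map_smul, map_smul, ← Module.End.mul_apply _ (sendLetter _ b),
    ← pow_succ]
  exact (convexOn_relEntropy q).2 (isLaw_pow k).nonneg (isLaw_pow (k + 1)).nonneg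
    (by linarith) (by linarith) (by ring)

lemma relEntropy_pow_sendLetter_le_of_ne [DecidableEq α] (h0 : 0 ≤ d) (h1 : d ≤ 1) (hab : a ≠ b)
    (k : ℕ) {ν : List α →₀ ℝ} (hν : IsLaw ν) :
    relEntropy ((sendLetter (1 / 2) b ^ k) (sendLetter d a ν)) (stringWeight b 0) ≤
      d * relEntropy ((sendLetter (1 / 2) b ^ k) ν) (stringWeight b 0) +
        (1 - d) * (relEntropy (fairBinom k) runWeight + relEntropy ν (stringWeight a 0)) := by
  have isLaw_pow {ν : List α →₀ ℝ} (hν : IsLaw ν) :=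
    hν.sendLetter_pow (d := 1 / 2) (by norm_num) (by norm_num) b k
  rw [← relEntropy_sendLetter_half_pow_mapDomain_cons hab k hν, sendLetter_apply, map_add,
    map_smul, map_smul]
  exact (convexOn_relEntropy _).2 (isLaw_pow hν).nonneg (isLaw_pow (hν.mapDomain _)).nonneg h0
    (sub_nonneg.2 h1) (add_sub_cancel d 1)

lemma relEntropy_pow_sendLetter_law_le [DecidableEq α] (h0 : 1 / 2 ≤ d) (h1 : d ≤ 1) (x : List α)
    (b : α) (k : ℕ) :
    relEntropy ((sendLetter (1 / 2) b ^ k) (law d x)) (stringWeight b 0) ≤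
      Real.log Real.goldenRatio * ((1 - d) * x.length + k / 2 + 1) := by
  have hd : 0 ≤ d := by linarith
  induction x generalizing b k with
  | nil =>
    rw [law, relEntropy_sendLetter_half_pow_single_nil]
    simpa using relEntropy_fairBinom_runWeight_le k
  | cons a x ih =>
    have hν : IsLaw (law d x) := isLaw_law hd h1 x
    rw [law_cons, List.length_cons, Nat.cast_succ]
    rcases eq_or_ne a b with rfl | hab
    · have bound_succ := ih a (k + 1)
      rw [Nat.cast_succ] at bound_succ
      calc _ ≤ _ := relEntropy_pow_sendLetter_self_le h0 h1 a k hν _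
        _ ≤ _ := add_le_add (mul_le_mul_of_nonneg_left (ih a k) (by linarith))
            (mul_le_mul_of_nonneg_left bound_succ (by linarith))
        _ = _ := by ring
    · have bound_zero := ih a 0
      simp only [pow_zero, Module.End.one_apply, Nat.cast_zero, zero_div, add_zero] at bound_zero
      calc _ ≤ _ := relEntropy_pow_sendLetter_le_of_ne hd h1 hab k hν
        _ ≤ _ := add_le_add (mul_le_mul_of_nonneg_left (ih b k) hd)
            (mul_le_mul_of_nonneg_left
              (add_le_add (relEntropy_fairBinom_runWeight_le k) bound_zero) (sub_nonneg.2 h1))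
        _ = _ := by ring

end StringWeight

section Capacity

variable {d c : ℝ} {n : ℕ}

lemma isLaw_blockLaw (h0 : 0 ≤ d) (h1 : d ≤ 1) (x : Fin n → Bool) : IsLaw (blockLaw d n x) :=
  isLaw_law h0 h1 _

lemma blockLaw_add (d : ℝ) {m : ℕ} (x : Fin (m + n) → Bool) :
    blockLaw d (m + n) x =
      (prodLaw (blockLaw d m fun i => x (i.castAdd n)) (blockLaw d n fun i => x (i.natAdd m))
        ).mapDomain fun z => z.1 ++ z.2 := by
  rw [blockLaw, List.ofFn_add, law_append]
  rfl

/-- The divergence radius of the channel of `n` uses of the deletion channel is, asymptotically, at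
most `c` bits per use. -/
def HasDivergenceRateLE (d c : ℝ) : Prop :=
  ∃ r : ℕ → ℝ, Tendsto (fun n => r n / n) atTop (𝓝 (c * Real.log 2)) ∧
    ∀ n, HasDivergenceRadiusLE (blockLaw d n) (r n)

lemma tendsto_mul_add_log_div (a b : ℝ) :
    Tendsto (fun n : ℕ => (n * a + b + Real.log (n + 1)) / n) atTop (𝓝 a) := by
  have tendsto_log : Tendsto (fun n : ℕ => Real.log (n + 1) / n) atTop (𝓝 0) := by
    simpa [Function.comp_def] using
      (Real.tendsto_pow_log_div_mul_add_atTop 1 (-1) 1 one_ne_zero).comp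
        (tendsto_atTop_add_const_right _ (1 : ℝ) tendsto_natCast_atTop_atTop)
  have tendsto_sum := ((tendsto_const_nhds (x := a)).add
    (tendsto_const_div_atTop_nhds_zero_nat b)).add tendsto_log
  rw [add_zero, add_zero] at tendsto_sum
  refine tendsto_sum.congr' ?_
  filter_upwards [eventually_ne_atTop 0] with n hn
  rw [add_div, add_div, mul_div_cancel_left₀ _ (Nat.cast_ne_zero.2 hn)]

lemma hasDivergenceRateLE_one (h0 : 0 ≤ d) (h1 : d ≤ 1) : HasDivergenceRateLE d 1 := by
  refine ⟨fun n => n * (1 * Real.log 2) + Real.log 2 + Real.log (n + 1),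
    tendsto_mul_add_log_div _ _, fun n => ?_⟩
  have sum_one_le : ∑ _y ∈ stringsLE Bool n, (1 : ℝ) ≤ 2 ^ (n + 1) := by
    rw [Finset.sum_const, nsmul_one]
    exact_mod_cast card_stringsLE_bool_le n
  refine (hasDivergenceRadiusLE_of_sum_le (isLaw_blockLaw h0 h1) (fun _ => one_pos)
    (fun x => support_law_subset (List.length_ofFn (f := x)).le) (by positivity) sum_one_le
    fun x => relEntropy_one_nonpos (isLaw_blockLaw h0 h1 x)).mono ?_
  have log_nonneg : 0 ≤ Real.log ((n : ℝ) + 1) := Real.log_nonneg (by simp)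
  rw [Real.log_pow]
  push_cast
  linarith

lemma hasDivergenceRateLE_goldenRatio (h0 : 1 / 2 ≤ d) (h1 : d ≤ 1) :
    HasDivergenceRateLE d ((1 - d) * Real.logb 2 Real.goldenRatio) := by
  refine ⟨fun n => Real.log Real.goldenRatio * ((1 - d) * n + 1) + Real.log (n + 1), ?_,
    fun n => ?_⟩
  · convert tendsto_mul_add_log_div ((1 - d) * Real.log Real.goldenRatio)
      (Real.log Real.goldenRatio) using 2 with n
    · ring
    · rw [mul_assoc, Real.logb, div_mul_cancel₀ _ (Real.log_pos one_lt_two).ne']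
  · refine hasDivergenceRadiusLE_of_sum_le (isLaw_blockLaw (by linarith) h1)
      (stringWeight_pos false 0)
      (fun x => support_law_subset (List.length_ofFn (f := x)).le) (by positivity)
      ((sum_stringWeight_bool_le n false 0).trans (mul_le_of_le_one_right (by positivity)
        (by simpa only [zero_add] using sum_runWeight_le_one _))) fun x => ?_
    simpa [blockLaw] using relEntropy_pow_sendLetter_law_le h0 h1 (List.ofFn x) false 0

lemma mutualInfo_eq_info_div (d : ℝ) (P : (Fin n → Bool) → ℝ) :
    mutualInfo d P =
      info (Finsupp.equivFunOnFinite.symm P) (blockLaw d n) / Real.log 2 := by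
  have outputProb_eq (y : List Bool) : Finsupp.linearCombination ℝ (blockLaw d n)
      (Finsupp.equivFunOnFinite.symm P) y = outputProb d P y := by
    rw [Finsupp.linearCombination_apply, Finsupp.sum_fintype _ _ (by simp)]
    simp [outputProb, transition_eq_blockLaw]
  rw [info, linearCombination_eq_sum (Finset.subset_univ _), mutualInfo, Finset.sum_div]
  refine Finset.sum_congr rfl fun x _ => ?_
  rw [relEntropy_eq_sum (support_blockLaw_subset d x), Finset.mul_sum, Finset.sum_div]
  refine Finset.sum_congr rfl fun y _ => ?_
  rw [klTerm, outputProb_eq, transition_eq_blockLaw, Real.logb,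
    Finsupp.equivFunOnFinite_symm_apply_apply]
  ring

lemma maxMutualInfo_le {r : ℝ} (h : ∀ P, IsLaw P → info P (blockLaw d n) ≤ r) :
    maxMutualInfo d n ≤ r / Real.log 2 := by
  refine csSup_le (Set.Nonempty.image _ ⟨_, single_mem_stdSimplex ℝ fun _ => false⟩) ?_
  rintro _ ⟨P, hP, rfl⟩
  simp only [mutualInfo_eq_info_div]
  exact div_le_div_of_nonneg_right (h _ (isLaw_equivFunOnFinite_symm.2 hP))
    (Real.log_nonneg one_le_two)

lemma info_div_le_maxMutualInfo (h0 : 0 ≤ d) (h1 : d ≤ 1) {P : (Fin n → Bool) →₀ ℝ}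
    (hP : IsLaw P) : info P (blockLaw d n) / Real.log 2 ≤ maxMutualInfo d n := by
  obtain ⟨r, -, hr⟩ := hasDivergenceRateLE_one h0 h1
  refine le_csSup ⟨r n / Real.log 2, ?_⟩
    ⟨P, isLaw_equivFunOnFinite_symm.1 (by simpa using hP), by simp [mutualInfo_eq_info_div]⟩
  rintro _ ⟨P, hP, rfl⟩
  simp only [mutualInfo_eq_info_div]
  exact div_le_div_of_nonneg_right
    ((hr n).info_le (isLaw_equivFunOnFinite_symm.2 hP) (isLaw_blockLaw h0 h1))
    (Real.log_nonneg one_le_two)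

lemma maxMutualInfo_nonneg (h0 : 0 ≤ d) (h1 : d ≤ 1) (n : ℕ) : 0 ≤ maxMutualInfo d n :=
  (div_nonneg (info_nonneg (isLaw_single fun _ => false) (isLaw_blockLaw h0 h1))
    (Real.log_nonneg one_le_two)).trans (info_div_le_maxMutualInfo h0 h1 (isLaw_single _))

lemma maxMutualInfo_add_le (h0 : 0 ≤ d) (h1 : d ≤ 1) (m n : ℕ) :
    maxMutualInfo d (m + n) ≤ maxMutualInfo d m + maxMutualInfo d n := by
  have log_two_pos : 0 < Real.log 2 := Real.log_pos one_lt_two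
  rw [← mul_div_cancel_right₀ (maxMutualInfo d m + maxMutualInfo d n) log_two_pos.ne']
  refine maxMutualInfo_le fun P hP => ?_
  have info_le := info_mapDomain_prodLaw_le hP (isLaw_blockLaw h0 h1) (isLaw_blockLaw h0 h1)
    (fun z : List Bool × List Bool => z.1 ++ z.2) (fun x (i : Fin m) => x (i.castAdd n))
    fun x (i : Fin n) => x (i.natAdd m)
  simp only [← blockLaw_add] at info_le
  rw [add_mul]
  exact info_le.trans (add_le_add
    ((div_le_iff₀ log_two_pos).1 (info_div_le_maxMutualInfo h0 h1 (hP.mapDomain _)))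
    ((div_le_iff₀ log_two_pos).1 (info_div_le_maxMutualInfo h0 h1 (hP.mapDomain _))))

lemma tendsto_maxMutualInfo_div (h0 : 0 ≤ d) (h1 : d ≤ 1) :
    Tendsto (fun n : ℕ => maxMutualInfo d n / n) atTop (𝓝 (informationCapacity d)) := by
  have subadditive : Subadditive (maxMutualInfo d) := maxMutualInfo_add_le h0 h1
  refine tendsto_nhds_limUnder ⟨_, subadditive.tendsto_lim ⟨0, ?_⟩⟩
  rintro _ ⟨n, rfl⟩
  exact div_nonneg (maxMutualInfo_nonneg h0 h1 n) n.cast_nonneg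

lemma HasDivergenceRateLE.informationCapacity_le (h : HasDivergenceRateLE d c) (h0 : 0 ≤ d)
    (h1 : d ≤ 1) : informationCapacity d ≤ c := by
  obtain ⟨r, hlim, hr⟩ := h
  have hlim' := hlim.div_const (Real.log 2)
  rw [mul_div_cancel_right₀ _ (Real.log_pos one_lt_two).ne'] at hlim'
  refine le_of_tendsto_of_tendsto' (tendsto_maxMutualInfo_div h0 h1) hlim' fun n => ?_
  rw [div_right_comm]
  exact div_le_div_of_nonneg_right
    (maxMutualInfo_le fun P hP => (hr n).info_le hP (isLaw_blockLaw h0 h1)) n.cast_nonneg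

lemma isAchievableRate_zero (d : ℝ) : IsAchievableRate d 0 := fun ε hε =>
  .of_forall fun n => ⟨1, fun _ _ => false, fun _ => 0, by simp, by
    simp [failureProb, Subsingleton.elim _ (0 : Fin 1), hε.le]⟩

lemma one_sub_failureProb_mul_log_le (h0 : 0 ≤ d) (h1 : d ≤ 1) {r : ℝ}
    (h : HasDivergenceRadiusLE (blockLaw d n) r) {M : ℕ} (hM : M ≠ 0)
    (enc : Fin M → Fin n → Bool) (dec : List Bool → Fin M) :
    (1 - failureProb d enc dec) * Real.log M ≤ r + 1 := by
  have : NeZero M := ⟨hM⟩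
  simpa only [Fintype.card_fin, ← failureProb_eq_codeFailureProb] using
    h.one_sub_codeFailureProb_mul_log_card_le (isLaw_blockLaw h0 h1) enc dec

lemma HasDivergenceRateLE.one_sub_mul_le_of_isAchievableRate (h : HasDivergenceRateLE d c)
    (h0 : 0 ≤ d) (h1 : d ≤ 1) {R : ℝ} (hR : IsAchievableRate d R) (hR0 : 0 ≤ R) {ε : ℝ}
    (hε : ε ∈ Set.Ioo (0 : ℝ) 1) : (1 - ε) * (R * Real.log 2) ≤ c * Real.log 2 := by
  obtain ⟨r, hlim, hr⟩ := h
  have hlim' : Tendsto (fun n : ℕ => (r n + 1) / n) atTop (𝓝 (c * Real.log 2)) := by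
    simpa only [add_div, add_zero] using hlim.add (tendsto_const_div_atTop_nhds_zero_nat 1)
  refine ge_of_tendsto hlim' ?_
  filter_upwards [hR ε hε.1, eventually_gt_atTop 0] with n ⟨M, enc, dec, hM, hfail⟩ hn
  have M_pos : (0 : ℝ) < M := lt_of_lt_of_le (by positivity) hM
  have le_log : n * R * Real.log 2 ≤ Real.log M := by
    rw [← Real.log_rpow two_pos]
    exact Real.log_le_log (by positivity) hM
  rw [le_div_iff₀ (Nat.cast_pos.2 hn)]
  calc (1 - ε) * (R * Real.log 2) * n = (1 - ε) * (n * R * Real.log 2) := by ring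
    _ ≤ (1 - failureProb d enc dec) * Real.log M :=
        mul_le_mul (by linarith) le_log (by positivity) (by linarith [hε.2])
    _ ≤ r n + 1 := one_sub_failureProb_mul_log_le h0 h1 (hr n) (Nat.cast_pos.1 M_pos).ne' enc dec

lemma HasDivergenceRateLE.le_of_isAchievableRate (h : HasDivergenceRateLE d c) (h0 : 0 ≤ d)
    (h1 : d ≤ 1) {R : ℝ} (hR : IsAchievableRate d R) : R ≤ c := by
  wlog hR0 : 0 ≤ R generalizing R
  · exact (le_of_not_ge hR0).trans (this (isAchievableRate_zero d) le_rfl)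
  have hlim : Tendsto (fun ε : ℝ => (1 - ε) * (R * Real.log 2)) (𝓝[>] 0)
      (𝓝 (R * Real.log 2)) := by
    refine (Continuous.tendsto' ?_ 0 _ (by simp)).mono_left nhdsWithin_le_nhds
    fun_prop
  refine le_of_mul_le_mul_right (le_of_tendsto hlim ?_) (Real.log_pos one_lt_two)
  filter_upwards [Ioo_mem_nhdsGT one_pos] with ε hε
  exact h.one_sub_mul_le_of_isAchievableRate h0 h1 hR hR0 hε

lemma isLUB_capacity (h0 : 0 ≤ d) (h1 : d ≤ 1) :
    IsLUB {R : ℝ | IsAchievableRate d R} (capacity d) :=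
  isLUB_csSup ⟨0, isAchievableRate_zero d⟩
    ⟨1, fun _ hR => (hasDivergenceRateLE_one h0 h1).le_of_isAchievableRate h0 h1 hR⟩

lemma HasDivergenceRateLE.capacity_le (h : HasDivergenceRateLE d c) (h0 : 0 ≤ d) (h1 : d ≤ 1) :
    capacity d ≤ c :=
  (isLUB_capacity h0 h1).2 fun _ hR => h.le_of_isAchievableRate h0 h1 hR

lemma le_one_sub_mul_logb_of_convexOn {F : ℝ → ℝ}
    (hF : ConvexOn ℝ (Set.Icc (0 : ℝ) (1 / 2)) F) (hF0 : F 0 ≤ 1)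
    (hF1 : F (1 / 2) ≤ (1 - 1 / 2) * Real.logb 2 Real.goldenRatio)
    (hd : d ∈ Set.Icc (0 : ℝ) (1 / 2)) : F d ≤ 1 - d * Real.logb 2 (4 / Real.goldenRatio) := by
  have one_sub_nonneg : 0 ≤ 1 - 2 * d := by linarith [hd.2]
  have two_mul_nonneg : 0 ≤ 2 * d := by linarith [hd.1]
  have logb_four : Real.logb 2 4 = 2 := by
    rw [show (4 : ℝ) = 2 ^ (2 : ℝ) by norm_num, Real.logb_rpow two_pos one_lt_two.ne']
  have chord := hF.2 (Set.left_mem_Icc.2 (by norm_num)) (Set.right_mem_Icc.2 (by norm_num))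
    one_sub_nonneg two_mul_nonneg (by ring)
  simp only [smul_eq_mul, mul_zero, zero_add, show 2 * d * (1 / 2) = d by ring] at chord
  calc F d ≤ (1 - 2 * d) * F 0 + 2 * d * F (1 / 2) := chord
    _ ≤ (1 - 2 * d) * 1 + 2 * d * ((1 - 1 / 2) * Real.logb 2 Real.goldenRatio) := by gcongr
    _ = 1 - d * Real.logb 2 (4 / Real.goldenRatio) := by
        rw [Real.logb_div four_ne_zero Real.goldenRatio_ne_zero, logb_four]
        ring

end Capacity

end DeletionChannel

end

theorem mainTheorem1 :
    -- both expressions for the capacity are well defined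
    (∀ d ∈ Set.Icc (0 : ℝ) 1,
      IsLUB {R : ℝ | DeletionChannel.IsAchievableRate d R} (DeletionChannel.capacity d)) ∧
    (∀ d ∈ Set.Icc (0 : ℝ) 1,
      Tendsto (fun n : ℕ => DeletionChannel.maxMutualInfo d n / n) atTop
        (𝓝 (DeletionChannel.informationCapacity d))) ∧
    -- the bounds for the largest achievable rate
    (∀ d ∈ Set.Icc (1 / 2 : ℝ) 1,
      DeletionChannel.capacity d ≤ (1 - d) * Real.logb 2 Real.goldenRatio) ∧
    (ConvexOn ℝ (Set.Icc (0 : ℝ) (1 / 2)) DeletionChannel.capacity →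
      ∀ d ∈ Set.Ico (0 : ℝ) (1 / 2),
        DeletionChannel.capacity d ≤ 1 - d * Real.logb 2 (4 / Real.goldenRatio)) ∧
    -- the bounds for the limit of the normalized mutual information
    (∀ d ∈ Set.Icc (1 / 2 : ℝ) 1,
      DeletionChannel.informationCapacity d ≤ (1 - d) * Real.logb 2 Real.goldenRatio) ∧
    (ConvexOn ℝ (Set.Icc (0 : ℝ) (1 / 2)) DeletionChannel.informationCapacity →
      ∀ d ∈ Set.Ico (0 : ℝ) (1 / 2),
        DeletionChannel.informationCapacity d ≤ 1 - d * Real.logb 2 (4 / Real.goldenRatio)) := by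
  have half : (1 / 2 : ℝ) ∈ Set.Icc (1 / 2 : ℝ) 1 := by constructor <;> norm_num
  have rate : ∀ d ∈ Set.Icc (1 / 2 : ℝ) 1,
      DeletionChannel.HasDivergenceRateLE d ((1 - d) * Real.logb 2 Real.goldenRatio) :=
    fun d hd => DeletionChannel.hasDivergenceRateLE_goldenRatio hd.1 hd.2
  have rate_zero := DeletionChannel.hasDivergenceRateLE_one le_rfl zero_le_one
  have cap (d : ℝ) (hd : d ∈ Set.Icc (1 / 2 : ℝ) 1) :=
    (rate d hd).capacity_le (one_half_pos.le.trans hd.1) hd.2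
  have infoCap (d : ℝ) (hd : d ∈ Set.Icc (1 / 2 : ℝ) 1) :=
    (rate d hd).informationCapacity_le (one_half_pos.le.trans hd.1) hd.2
  exact ⟨fun d hd => DeletionChannel.isLUB_capacity hd.1 hd.2,
    fun d hd => DeletionChannel.tendsto_maxMutualInfo_div hd.1 hd.2,
    cap,
    fun hconv d hd => DeletionChannel.le_one_sub_mul_logb_of_convexOn hconv
      (rate_zero.capacity_le le_rfl zero_le_one) (cap _ half) (Set.Ico_subset_Icc_self hd),
    infoCap,
    fun hconv d hd => DeletionChannel.le_one_sub_mul_logb_of_convexOn hconv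
      (rate_zero.informationCapacity_le le_rfl zero_le_one) (infoCap _ half)
      (Set.Ico_subset_Icc_self hd)⟩
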